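/- Theorem 1. Let $(\Omega,\mathcal F,\Pr)$ be a probability space, let $\mathbb X\subset\mathbb R^d$ carry its Borel $\sigma$-algebra, let $X:\Omega\to\mathbb X$ be a random variable, and let $X_1,X_2,\dots:\Omega\to\mathbb X$ be independent random variables with the same distribution as $X$. Let $m\ge 1$. For $k\in[m]=\{1,\dots,m\}$ let $\mathbb T_k\subset\mathbb R^{q_k}$, let $h_k(\cdot;\theta):\mathbb X\to\mathbb R$ ($\theta\in\mathbb T_k$) be functions, let $\ell:\mathbb R\to\mathbb R$ be a loss function, put $\ell_k(x;\theta)=\ell(h_k(x;\theta))$, and assume that $\ell_k(\cdot;\theta)$ is measurable for each $\theta\in\mathbb T_k$. Write $$R_{k,n}(\theta)=\frac1n\sum_{i=1}^n \ell_k(X_i;\theta),\qquad r_k(\theta)=\mathrm E\{\ell_k(X;\theta)\}.$$ Let $P_{k,n}:\Omega\to\mathbb R$ ($k\in[m]$, $n\ge1$) be random variables. Assume, for each $k\in[m]$: (A1) $\mathbb T_k$ is compact, and there is a $\tau_k\in\mathbb T_k$ with $\mathrm E\{\ell_k(X;\tau_k)^2\}<\infty$. (A2) There is a measurable function $C_k:\mathbb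 X\to\mathbb R_{\ge0}$ with $\mathrm E\{C_k(X)^2\}<\infty$ such that, for almost every $x\in\mathbb X$ (with respect to the law of $X$), $|\ell_k(x;\theta)-\ell_k(x;\tau)|\le C_k(x)\|\theta-\tau\|$ for all $\theta,\tau\in\mathbb T_k$, where $\|\cdot\|$ is the Euclidean norm. (B1) $P_{k,n}>0$ for all $n\ge1$, and $P_{k,n}\to0$ in probability as $n\to\infty$. (B2) For every $l\in[m]$ with $k<l$, $\sqrt n\,(P_{l,n}-P_{k,n})\to\infty$ in probability as $n\to\infty$, that is, $\Pr(\sqrt n\,(P_{l,n}-P_{k,n})>M)\to1$ for every $M\in\mathbb R$. Then each $\ell_k(X;\theta)$ is integrable, $r_k$ attains its minimum on $\mathbb T_k$, and for each $n\ge1$, almost surely, $R_{k,n}$ attains its minimum on $\mathbb T_k$ for every $k\in[m]$. Let $$k^*=\min\,\underset{k\in[m]}{\arg\min}\Big\{\min_{\theta\in\mathbb T_k} r_k(\theta)\Big\},\qquad \hat K_n=\min\,\underset{k\in[m]}{\arg\min}\Big\{\min_{\theta\in\mathbb T_k} R_{k,n}(\theta)+P_{k,n}\Big\}$$ (where, on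 the null set on which some minimum of $R_{k,n}$ is not attained, $\hat K_n$ may be defined arbitrarily). Then $\hat K_n$ is, up to a null set, a random variable for each $n\ge 1$, and $$\lim_{n\to\infty}\Pr(\hat K_n=k^*)=1.$$ -/

import Mathlib

open MeasureTheory ProbabilityTheory Filter Topology
open scoped NNReal

/-- The smallest element of `argmin_{k} f k`, for a real function on a finite nonempty linear index
set `{1, …, m}`, represented by `Fin m`. -/
noncomputable def minArgmin {m : ℕ} [NeZero m] (f : Fin m → ℝ) : Fin m :=
  (Finset.univ.filter (fun k => ∀ l, f k ≤ f l)).min' (by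
    obtain ⟨k, hk⟩ := Finite.exists_min f
    exact ⟨k, by simpa using hk⟩)

section Risks

variable {Ω 𝕏 Θ : Type*} [MeasurableSpace Ω]

/-- Empirical risk `R_n(θ) = (1/n) ∑_{i=1}^n L(X_i; θ)` at the sample point `ω`; the observations
`X_1, …, X_n` are `Xs 0, …, Xs (n - 1)`. -/
noncomputable def empRisk (L : 𝕏 → Θ → ℝ) (Xs : ℕ → Ω → 𝕏) (n : ℕ) (ω : Ω) (θ : Θ) : ℝ :=
  (1 / (n : ℝ)) * ∑ i ∈ Finset.range n, L (Xs i ω) θ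

/-- Expected risk `r(θ) = E {L(X; θ)}`. -/
noncomputable def expRisk (P : Measure Ω) (L : 𝕏 → Θ → ℝ) (X : Ω → 𝕏) (θ : Θ) : ℝ :=
  ∫ ω, L (X ω) θ ∂P

end Risks

section Indices

variable {Ω 𝕏 : Type*} [MeasurableSpace Ω] {m : ℕ} [NeZero m] {Θ : Fin m → Type*}

/-- The optimal index: the smallest `k` that minimises `min_θ r_k(θ)`. -/
noncomputable def optIndex (P : Measure Ω) (L : (k : Fin m) → 𝕏 → Θ k → ℝ) (X : Ω → 𝕏) : Fin m :=
  minArgmin (fun k => ⨅ θ : Θ k, expRisk P (L k) X θ)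

/-- The penalised estimator: the smallest `k` that minimises `min_θ R_{k,n}(θ) + P_{k,n}`. -/
noncomputable def penEstimator (L : (k : Fin m) → 𝕏 → Θ k → ℝ) (Xs : ℕ → Ω → 𝕏)
    (pen : Fin m → ℕ → Ω → ℝ) (n : ℕ) (ω : Ω) : Fin m :=
  minArgmin (fun k => (⨅ θ : Θ k, empRisk (L k) Xs n ω θ) + pen k n ω)

end Indices

/-- The sequence `f n` of real random variables tends to `+∞` in probability. -/
def TendstoAtTopInProb {Ω : Type*} [MeasurableSpace Ω] (P : Measure Ω) (f : ℕ → Ω → ℝ) : Prop :=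
  ∀ M : ℝ, Tendsto (fun n => P {ω | M < f n ω}) atTop (𝓝 1)

/-! For each class, the supremum over θ of |R_{k,n}(θ) − r_k(θ)| is O(1/√n) in probability
(`exists_uniform_deviation_bound`). Taking infima does not increase a sup-distance, so the minimal
empirical risk is within O(1/√n) of the minimal expected risk. Now compare k* with another index l
(`tendsto_measure_minArgmin_eq`). If l has strictly larger minimal risk, the fixed gap beats the
noise and the vanishing penalty of k*. If the minimal risks are equal, then k* < l, and the penalty
gap, of larger order than 1/√n, beats the noise. There are finitely many l.

The uniform bound is obtained by chaining. The Lipschitz constant C(X) has only a second moment, so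
sums of increments need not have exponential tails. On the event that all C(X_i) ≤ M√n, which is
likely by Markov's inequality, the summands may be truncated and Chernoff's bound gives a tail exp(2
− u) (`measureReal_truncated_sum_ge_le`). Nets of radius of order 2^{-j} have at most D^j points, so
level j only needs u of order j (`measure_link_failure_le`). Since ∑ j 2^{-j} converges, the links
add up to a bounded multiple of √n (`abs_sub_le_of_nets`). -/

theorem ae_comp_of_identDistrib {Ω 𝕏 : Type*} [MeasurableSpace Ω] [MeasurableSpace 𝕏]
    {P : Measure Ω} {X Y : Ω → 𝕏} (hY : IdentDistrib Y X P P)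
    {p : 𝕏 → Prop} (hp : ∀ᵐ x ∂P.map X, p x) : ∀ᵐ ω ∂P, p (Y ω) := by
  rw [← hY.map_eq] at hp
  exact ae_of_ae_map hY.aemeasurable_fst hp

/-! ### Exponential tail bounds for truncated sums. -/

section Concentration

variable {Ω : Type*} [MeasurableSpace Ω] {P : Measure Ω} [IsProbabilityMeasure P]

/-- Integrate exp x ≤ 1 + x + x², valid for |x| ≤ 1, and use 1 + v ≤ exp v. -/
theorem mgf_one_le_exp_of_abs_le_one {x : Ω → ℝ} (hm : Measurable x)
    (hb : ∀ᵐ ω ∂P, |x ω| ≤ 1) {v : ℝ} (hv : ∫ ω, x ω ∂P + ∫ ω, x ω ^ 2 ∂P ≤ v) :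
    mgf x P 1 ≤ Real.exp v := by
  have hx : Integrable x P := Integrable.of_bound hm.aestronglyMeasurable 1 (by simpa using hb)
  have hx2 : Integrable (fun ω => x ω ^ 2) P := by
    refine Integrable.of_bound (hm.pow_const 2).aestronglyMeasurable 1 ?_
    filter_upwards [hb] with ω hω
    rw [Real.norm_eq_abs, abs_pow]
    exact pow_le_one₀ (abs_nonneg _) hω
  have he : Integrable (fun ω => Real.exp (1 * x ω)) P := by
    refine Integrable.of_bound (by fun_prop) (Real.exp 1) ?_
    filter_upwards [hb] with ω hω
    rw [Real.norm_eq_abs, abs_of_pos (Real.exp_pos _), one_mul]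
    exact Real.exp_le_exp.2 ((le_abs_self _).trans hω)
  have hi : Integrable (fun ω => (1 + x ω) + x ω ^ 2) P :=
    ((integrable_const 1).add hx).add hx2
  calc mgf x P 1 ≤ ∫ ω, ((1 + x ω) + x ω ^ 2) ∂P := by
        refine integral_mono_ae he hi ?_
        filter_upwards [hb] with ω hω
        have := (abs_le.1 (Real.abs_exp_sub_one_sub_id_le hω)).2
        simp only [one_mul]
        linarith
    _ = 1 + (∫ ω, x ω ∂P + ∫ ω, x ω ^ 2 ∂P) := by
        rw [integral_add (f := fun ω => 1 + x ω) ((integrable_const 1).add hx) hx2,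
          integral_add (integrable_const 1) hx]
        simp [add_assoc]
    _ ≤ Real.exp v := by linarith [Real.add_one_le_exp v]

/-- Chernoff's bound at parameter 1. There is nothing to optimise, since the summands will already
be scaled to make this parameter adequate. -/
theorem measureReal_sum_ge_le_exp {x : ℕ → Ω → ℝ} (hm : ∀ i, Measurable (x i))
    (hind : iIndepFun x P) (hb : ∀ i, ∀ᵐ ω ∂P, |x i ω| ≤ 1) {v : ℝ} {n : ℕ} (hn : 1 ≤ n)
    (hv : ∀ i, ∫ ω, x i ω ∂P + ∫ ω, x i ω ^ 2 ∂P ≤ v / n) (u : ℝ) :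
    P.real {ω | u ≤ ∑ i ∈ Finset.range n, x i ω} ≤ Real.exp (v - u) := by
  have hint : Integrable (fun ω => Real.exp (1 * (∑ i ∈ Finset.range n, x i) ω)) P := by
    refine hind.integrable_exp_mul_sum hm fun i _ => ?_
    refine Integrable.of_bound (by have := hm i; fun_prop) (Real.exp 1) ?_
    filter_upwards [hb i] with ω hω
    rw [Real.norm_eq_abs, abs_of_pos (Real.exp_pos _), one_mul]
    exact Real.exp_le_exp.2 ((le_abs_self _).trans hω)
  have h1 := measure_ge_le_exp_mul_mgf (μ := P) (X := ∑ i ∈ Finset.range n, x i) u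
    zero_le_one hint
  rw [hind.mgf_sum hm] at h1
  have h2 : ∏ i ∈ Finset.range n, mgf (x i) P 1 ≤ Real.exp v := by
    calc ∏ i ∈ Finset.range n, mgf (x i) P 1 ≤ ∏ i ∈ Finset.range n, Real.exp (v / n) :=
          Finset.prod_le_prod (fun i _ => mgf_nonneg)
            fun i _ => mgf_one_le_exp_of_abs_le_one (hm i) (hb i) (hv i)
      _ = Real.exp v := by
          rw [Finset.prod_const, Finset.card_range, ← Real.exp_nat_mul]
          congr 1
          have : (n : ℝ) ≠ 0 := by positivity
          field_simp
  simp only [Finset.sum_apply] at h1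
  refine h1.trans ?_
  calc _ ≤ Real.exp (-1 * u) * Real.exp v := by gcongr
    _ = Real.exp (v - u) := by rw [← Real.exp_add]; ring_nf

variable {𝕏 : Type*} [MeasurableSpace 𝕏] {X : Ω → 𝕏} {Xs : ℕ → Ω → 𝕏}

/-- One-sided exponential bound for centred sums of variables with a square integrable envelope,
on the event that the envelope does not exceed the truncation level. -/
theorem measureReal_truncated_sum_ge_le (hX : Measurable X) (hXs : ∀ i, Measurable (Xs i))
    (hindep : iIndepFun Xs P) (hident : ∀ i, IdentDistrib (Xs i) X P P)
    {φ C : 𝕏 → ℝ} (hφ : Measurable φ) (hC : Measurable C) (hC0 : ∀ x, 0 ≤ C x)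
    {δ M : ℝ} (hδ : 0 < δ) (hM : 0 < M) (hφC : ∀ᵐ x ∂P.map X, |φ x| ≤ C x * δ)
    (hCint : Integrable (fun ω => C (X ω) ^ 2) P) (hCM : ∫ ω, C (X ω) ^ 2 ∂P ≤ M ^ 2)
    {n : ℕ} (hn : 1 ≤ n) (u : ℝ) :
    P.real {ω | (∀ i ∈ Finset.range n, C (Xs i ω) ≤ M * √n) ∧
      2 * δ * M * √n * u ≤ ∑ i ∈ Finset.range n, (φ (Xs i ω) - ∫ ω, φ (X ω) ∂P)}
      ≤ Real.exp (2 - u) := by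
  set μ := ∫ ω, φ (X ω) ∂P with hμ
  have hn0 : (1 : ℝ) ≤ n := by exact_mod_cast hn
  have hs1 : 1 ≤ √(n : ℝ) := Real.one_le_sqrt.2 hn0
  have hs0 : 0 < √(n : ℝ) := by linarith
  have hss : √(n : ℝ) * √n = n := Real.mul_self_sqrt (by linarith)
  set s := √(n : ℝ) with hs
  set A : Set 𝕏 := {x | C x ≤ M * s} with hA
  have hAm : MeasurableSet A := measurableSet_le hC measurable_const
  -- The truncated φ and its centring μ are each at most δM√n in absolute value, so division by a
  -- leaves values in [−1, 1].
  set a := 2 * δ * M * s with ha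
  have ha0 : 0 < a := by positivity
  -- The centring is the mean of φ before truncation, so that ψ reproduces the original summands on
  -- A; the resulting bias is bounded in `hmean`.
  set ψ : 𝕏 → ℝ := fun x => (A.indicator φ x - μ) / a with hψ
  have hψm : Measurable ψ := ((hφ.indicator hAm).sub_const μ).div_const a
  have hφX : ∀ᵐ ω ∂P, |φ (X ω)| ≤ C (X ω) * δ := ae_of_ae_map hX.aemeasurable hφC
  have hC1 : Integrable (fun ω => C (X ω)) P := by
    have : MemLp (fun ω => C (X ω)) 2 P :=
      (memLp_two_iff_integrable_sq (hC.comp hX).aestronglyMeasurable).2 hCint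
    exact this.integrable (by norm_num)
  have hφi : Integrable (fun ω => φ (X ω)) P :=
    (hC1.mul_const δ).mono' (hφ.comp hX).aestronglyMeasurable hφX
  have hEC : ∫ ω, C (X ω) ∂P ≤ M := by
    -- Integrated form of 2MC ≤ C² + M².
    have h1 : ∫ ω, C (X ω) ∂P ≤ ∫ ω, (C (X ω) ^ 2 + M ^ 2) / (2 * M) ∂P := by
      refine integral_mono hC1 ((hCint.add (integrable_const _)).div_const _) fun ω => ?_
      simp only
      rw [le_div_iff₀ (by positivity)]
      nlinarith [sq_nonneg (C (X ω) - M)]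
    rw [integral_div, integral_add hCint (integrable_const _)] at h1
    simp only [integral_const, probReal_univ, one_smul] at h1
    refine h1.trans ?_
    rw [div_le_iff₀ (by positivity)]
    nlinarith
  have hμM : |μ| ≤ M * δ := by
    calc |μ| ≤ ∫ ω, |φ (X ω)| ∂P := abs_integral_le_integral_abs
      _ ≤ ∫ ω, C (X ω) * δ ∂P := integral_mono_ae hφi.abs (hC1.mul_const δ) hφX
      _ = (∫ ω, C (X ω) ∂P) * δ := integral_mul_const _ _
      _ ≤ M * δ := by gcongr
  have hind_le : ∀ᵐ ω ∂P, |A.indicator φ (X ω)| ≤ δ * M * s := by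
    filter_upwards [hφX] with ω hω
    by_cases h : X ω ∈ A
    · rw [Set.indicator_of_mem h]
      refine hω.trans ?_
      have : C (X ω) ≤ M * s := h
      nlinarith
    · rw [Set.indicator_of_notMem h, abs_zero]; positivity
  have hindC : ∀ᵐ ω ∂P, |A.indicator φ (X ω)| ≤ C (X ω) * δ := by
    filter_upwards [hφX] with ω hω
    by_cases h : X ω ∈ A
    · rwa [Set.indicator_of_mem h]
    · rw [Set.indicator_of_notMem h, abs_zero]; exact mul_nonneg (hC0 _) hδ.le
  have hindi : Integrable (fun ω => A.indicator φ (X ω)) P :=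
    (hC1.mul_const δ).mono' ((hφ.indicator hAm).comp hX).aestronglyMeasurable hindC
  have hψb : ∀ᵐ ω ∂P, |ψ (X ω)| ≤ 1 := by
    filter_upwards [hind_le] with ω hω
    rw [hψ]
    simp only
    rw [abs_div, abs_of_pos ha0, div_le_one ha0]
    have h1 := abs_sub (A.indicator φ (X ω)) μ
    have : M * δ ≤ δ * M * s := by nlinarith [mul_pos hδ hM]
    linarith
  have hmean : ∫ ω, ψ (X ω) ∂P ≤ 1 / n := by
    -- Off A the factor C / (M√n) exceeds 1, so the discarded part |φ| ≤ δC is at most δC² / (M√n).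
    have h1 : ∫ ω, (A.indicator φ (X ω) - φ (X ω)) ∂P ≤ ∫ ω, δ * C (X ω) ^ 2 / (M * s) ∂P := by
      refine integral_mono_ae (hindi.sub hφi) ((hCint.const_mul δ).div_const _) ?_
      filter_upwards [hφX] with ω hω
      by_cases h : X ω ∈ A
      · rw [Set.indicator_of_mem h, sub_self]; positivity
      · rw [Set.indicator_of_notMem h, le_div_iff₀ (by positivity)]
        have h2 : M * s < C (X ω) := not_le.1 h
        have h3 := neg_abs_le (φ (X ω))
        have h4 : 0 < M * s := by positivity
        have h5 : 0 - φ (X ω) ≤ C (X ω) * δ := by linarith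
        calc (0 - φ (X ω)) * (M * s) ≤ (C (X ω) * δ) * (M * s) := by gcongr
          _ ≤ (C (X ω) * δ) * C (X ω) := by
            have := hC0 (X ω)
            gcongr
          _ = δ * C (X ω) ^ 2 := by ring
    rw [integral_sub hindi hφi, ← hμ, integral_div, integral_const_mul] at h1
    have h2 : ∫ ω, ψ (X ω) ∂P = (∫ ω, A.indicator φ (X ω) ∂P - μ) / a := by
      rw [hψ]; simp only
      rw [integral_div, integral_sub hindi (integrable_const _)]
      simp
    rw [h2, div_le_iff₀ ha0]
    refine h1.trans ?_
    rw [div_le_iff₀ (by positivity), ha, ← hss]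
    calc δ * ∫ ω, C (X ω) ^ 2 ∂P ≤ δ * M ^ 2 := by gcongr
      _ ≤ 2 * (δ * M ^ 2) := by nlinarith [mul_pos hδ (pow_pos hM 2)]
      _ = _ := by field_simp
  have hsecond : ∫ ω, ψ (X ω) ^ 2 ∂P ≤ 1 / n := by
    -- By (y − μ)² ≤ 2y² + 2μ², the numerator integrates to at most 4M²δ², which is a² / n.
    have hi : Integrable (fun ω => (2 * (C (X ω) ^ 2 * δ ^ 2) + 2 * (M * δ) ^ 2) / a ^ 2) P :=
      (((hCint.mul_const _).const_mul 2).add (integrable_const _)).div_const _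
    have h1 : ∫ ω, ψ (X ω) ^ 2 ∂P ≤
        ∫ ω, (2 * (C (X ω) ^ 2 * δ ^ 2) + 2 * (M * δ) ^ 2) / a ^ 2 ∂P := by
      refine integral_mono_of_nonneg (ae_of_all _ fun ω => sq_nonneg _) hi ?_
      filter_upwards [hindC] with ω hω
      rw [hψ]; simp only
      rw [div_pow]
      gcongr
      have h2 := sq_le_sq' (by linarith [neg_abs_le (A.indicator φ (X ω))])
        ((le_abs_self _).trans hω)
      have h3 := sq_le_sq' (by linarith [neg_abs_le μ]) ((le_abs_self _).trans hμM)
      nlinarith [sq_nonneg (A.indicator φ (X ω) + μ)]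
    refine h1.trans ?_
    rw [integral_div, integral_add ((hCint.mul_const _).const_mul 2) (integrable_const _),
      integral_const_mul, integral_mul_const]
    simp only [integral_const, probReal_univ, one_smul]
    rw [div_le_iff₀ (by positivity), ha, ← hss]
    calc _ ≤ 2 * (M ^ 2 * δ ^ 2) + 2 * (M * δ) ^ 2 := by gcongr
      _ = _ := by field_simp; ring
  have hid : ∀ i, IdentDistrib (fun ω => ψ (Xs i ω)) (fun ω => ψ (X ω)) P P :=
    fun i => (hident i).comp hψm
  have key := measureReal_sum_ge_le_exp (P := P) (x := fun i ω => ψ (Xs i ω))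
    (fun i => hψm.comp (hXs i)) (hindep.comp (fun _ => ψ) fun _ => hψm)
    (fun i => by
      have : ∀ᵐ y ∂P.map X, |ψ y| ≤ 1 :=
        (ae_map_iff hX.aemeasurable (measurableSet_le hψm.abs measurable_const)).2 hψb
      exact ae_comp_of_identDistrib (hident i) this) (v := 2) hn
    (fun i => by
      have h1 := (hid i).integral_eq
      have h2 := ((hid i).comp (u := fun y : ℝ => y ^ 2) (by fun_prop)).integral_eq
      simp only [Function.comp_def] at h2
      rw [h1, h2]
      calc _ ≤ 1 / (n : ℝ) + 1 / n := add_le_add hmean hsecond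
        _ = 2 / n := by ring) u
  refine (measureReal_mono ?_).trans key
  rintro ω ⟨h1, h2⟩
  have : ∑ i ∈ Finset.range n, ψ (Xs i ω) = (∑ i ∈ Finset.range n, (φ (Xs i ω) - μ)) / a := by
    rw [Finset.sum_div]
    refine Finset.sum_congr rfl fun i hi => ?_
    have : Xs i ω ∈ A := h1 i hi
    rw [hψ]; simp only
    rw [Set.indicator_of_mem this]
  simp only [Set.mem_ofPred_eq]
  rw [this, le_div_iff₀ ha0]
  linarith

/-- Two-sided version of `measureReal_truncated_sum_ge_le`. -/
theorem measureReal_truncated_abs_sum_ge_le (hX : Measurable X) (hXs : ∀ i, Measurable (Xs i))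
    (hindep : iIndepFun Xs P) (hident : ∀ i, IdentDistrib (Xs i) X P P)
    {φ C : 𝕏 → ℝ} (hφ : Measurable φ) (hC : Measurable C) (hC0 : ∀ x, 0 ≤ C x)
    {δ M : ℝ} (hδ : 0 < δ) (hM : 0 < M) (hφC : ∀ᵐ x ∂P.map X, |φ x| ≤ C x * δ)
    (hCint : Integrable (fun ω => C (X ω) ^ 2) P) (hCM : ∫ ω, C (X ω) ^ 2 ∂P ≤ M ^ 2)
    {n : ℕ} (hn : 1 ≤ n) (u : ℝ) :
    P.real {ω | (∀ i ∈ Finset.range n, C (Xs i ω) ≤ M * √n) ∧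
      2 * δ * M * √n * u ≤ |∑ i ∈ Finset.range n, (φ (Xs i ω) - ∫ ω, φ (X ω) ∂P)|}
      ≤ 2 * Real.exp (2 - u) := by
  have h1 := measureReal_truncated_sum_ge_le hX hXs hindep hident hφ hC hC0 hδ hM hφC hCint hCM
    hn u
  have h2 := measureReal_truncated_sum_ge_le hX hXs hindep hident hφ.neg hC hC0 hδ hM
    (by simpa using hφC) hCint hCM hn u
  rw [two_mul (Real.exp _)]
  refine le_trans ?_ (add_le_add h1 h2)
  refine (measureReal_mono ?_).trans (measureReal_union_le _ _)
  rintro ω ⟨h3, h4⟩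
  rcases le_abs.1 h4 with h | h
  · exact Or.inl ⟨h3, h⟩
  · refine Or.inr ⟨h3, h.trans_eq ?_⟩
    simp only [Pi.neg_apply, integral_neg, ← Finset.sum_neg_distrib]
    exact Finset.sum_congr rfl fun i _ => by ring

end Concentration

/-! ### Nets in finite dimension and deterministic chaining. -/

section Nets

/-- Cover the unit ball by D balls of radius 1/2, then cover each ball by a scaled copy of this
cover, repeatedly. -/
theorem exists_finset_cover_closedBall {E : Type*} [NormedAddCommGroup E] [NormedSpace ℝ E]
    [FiniteDimensional ℝ E] :
    ∃ D : ℕ, 1 ≤ D ∧ ∀ R : ℝ, 0 < R → ∀ j : ℕ, ∃ F : Finset E, F.card ≤ D ^ j ∧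
      ∀ x : E, ‖x‖ ≤ R → ∃ y ∈ F, ‖x - y‖ ≤ R * (1 / 2) ^ j := by
  classical
  have hc : IsCompact (Metric.closedBall (0 : E) 1) := isCompact_closedBall _ _
  obtain ⟨t, -, htf, ht⟩ := hc.finite_cover_balls (e := 1 / 2) (by norm_num)
  lift t to Finset E using htf
  have hne : t.Nonempty := by
    have := ht (Metric.mem_closedBall_self zero_le_one)
    simp only [Set.mem_iUnion] at this
    obtain ⟨y, hy, -⟩ := this
    exact ⟨y, hy⟩
  refine ⟨t.card, hne.card_pos, fun R hR j => ?_⟩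
  induction j with
  | zero => exact ⟨{0}, by simp, fun x hx => ⟨0, by simp, by simpa using hx⟩⟩
  | succ j ih =>
    obtain ⟨F, hF, hcov⟩ := ih
    have hr : 0 < R * (1 / 2) ^ j := by positivity
    set r := R * (1 / 2) ^ j with hr_def
    refine ⟨(F ×ˢ t).image fun p => p.1 + r • p.2, ?_, fun x hx => ?_⟩
    · refine Finset.card_image_le.trans ?_
      rw [Finset.card_product, pow_succ]
      gcongr
    · obtain ⟨y, hy, hxy⟩ := hcov x hx
      have hz : r⁻¹ • (x - y) ∈ Metric.closedBall (0 : E) 1 := by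
        rw [mem_closedBall_zero_iff, norm_smul, Real.norm_of_nonneg (inv_nonneg.2 hr.le),
          inv_mul_le_iff₀ hr, mul_one]
        exact hxy
      have := ht hz
      simp only [Set.mem_iUnion] at this
      obtain ⟨d, hd, hzd⟩ := this
      refine ⟨y + r • d, Finset.mem_image.2 ⟨(y, d), by simpa using ⟨hy, hd⟩, rfl⟩, ?_⟩
      have h1 : x - (y + r • d) = r • (r⁻¹ • (x - y) - d) := by
        rw [smul_sub, smul_inv_smul₀ hr.ne']; abel
      rw [h1, norm_smul, Real.norm_of_nonneg hr.le, pow_succ, ← mul_assoc, ← hr_def]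
      rw [Metric.mem_ball, dist_eq_norm] at hzd
      gcongr

/-- A bounded subset of a finite-dimensional space has inner nets of geometric radii and
geometrically bounded cardinalities. -/
theorem exists_nets_of_isBounded {E : Type*} [NormedAddCommGroup E] [NormedSpace ℝ E]
    [FiniteDimensional ℝ E] {T : Set E} (hT : Bornology.IsBounded T) :
    ∃ (D : ℕ) (R : ℝ) (S : ℕ → Finset T), 1 ≤ D ∧ (∀ j, (S j).card ≤ D ^ j) ∧
      ∀ (θ : T) (j : ℕ), ∃ s ∈ S j, dist θ s ≤ R * (1 / 2) ^ j := by
  classical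
  obtain ⟨D, hD, h⟩ := exists_finset_cover_closedBall (E := E)
  obtain ⟨R, hR, hTR⟩ := hT.exists_pos_norm_le
  choose F hF hcov using h R hR
  have hex : ∀ j, ∃ S : Finset T, S.card ≤ D ^ j ∧
      ∀ θ : T, ∃ s ∈ S, dist θ s ≤ 2 * R * (1 / 2) ^ j := by
    intro j
    -- The centres need not lie in T. Those near T are replaced by nearby points of T, which doubles
    -- the radius.
    let G := (F j).filter fun y => ∃ s : T, ‖(s : E) - y‖ ≤ R * (1 / 2) ^ j
    have hG : ∀ y : G, ∃ s : T, ‖(s : E) - y‖ ≤ R * (1 / 2) ^ j := fun y =>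
      (Finset.mem_filter.1 y.2).2
    choose g hg using hG
    refine ⟨Finset.univ.image g, ?_, fun θ => ?_⟩
    · refine Finset.card_image_le.trans ?_
      rw [Finset.card_univ, Fintype.card_coe]
      exact (Finset.card_filter_le _ _).trans (hF j)
    · obtain ⟨y, hy, hθy⟩ := hcov j θ (hTR θ θ.2)
      have hyG : y ∈ G := Finset.mem_filter.2 ⟨hy, θ, hθy⟩
      refine ⟨g ⟨y, hyG⟩, Finset.mem_image_of_mem _ (Finset.mem_univ _), ?_⟩
      have h1 := hg ⟨y, hyG⟩
      rw [Subtype.dist_eq, dist_eq_norm]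
      have h2 := norm_sub_le ((θ : E) - y) ((g ⟨y, hyG⟩ : E) - y)
      rw [sub_sub_sub_cancel_right] at h2
      linarith
  choose S hS hS' using hex
  exact ⟨D, 2 * R, S, hD, hS, fun θ j => hS' j θ⟩

/-- Deterministic chaining: a continuous function whose increments along the links of a sequence
of nets are controlled is uniformly bounded. -/
theorem abs_sub_le_of_nets {Θ : Type*} [PseudoMetricSpace Θ] {S : ℕ → Finset Θ} {R : ℝ}
    (hS : ∀ (θ : Θ) (j : ℕ), ∃ s ∈ S j, dist θ s ≤ R * (1 / 2) ^ j) {θ₀ : Θ} (hθ₀ : S 0 = {θ₀})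
    {Z : Θ → ℝ} (hZ : Continuous Z) {b : ℕ → ℝ} (hb : ∀ j, 0 ≤ b j)
    (hlink : ∀ j, ∀ s ∈ S j, ∀ t ∈ S (j + 1), |Z s - Z t| ≤ dist s t * b j)
    (hsum : Summable fun j => 2 * R * (1 / 2) ^ j * b j) (θ : Θ) :
    |Z θ - Z θ₀| ≤ ∑' j, 2 * R * (1 / 2) ^ j * b j := by
  choose π hπ hπd using hS θ
  have hR : 0 ≤ R := by simpa using dist_nonneg.trans (hπd 0)
  have h0 : π 0 = θ₀ := by simpa [hθ₀] using hπ 0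
  have hlim : Tendsto π atTop (𝓝 θ) := by
    rw [tendsto_iff_dist_tendsto_zero]
    refine squeeze_zero (fun _ => dist_nonneg) (fun j => (dist_comm _ _).trans_le (hπd j)) ?_
    simpa using (tendsto_pow_atTop_nhds_zero_of_lt_one (r := (1 / 2 : ℝ))
      (by norm_num) (by norm_num)).const_mul R
  have hstep : ∀ j, |Z (π (j + 1)) - Z (π j)| ≤ 2 * R * (1 / 2) ^ j * b j := by
    intro j
    rw [abs_sub_comm]
    refine (hlink j _ (hπ j) _ (hπ (j + 1))).trans ?_
    gcongr
    · exact hb j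
    calc dist (π j) (π (j + 1)) ≤ dist θ (π j) + dist θ (π (j + 1)) := dist_triangle_left _ _ _
      _ ≤ R * (1 / 2) ^ j + R * (1 / 2) ^ (j + 1) := add_le_add (hπd _) (hπd _)
      _ ≤ 2 * R * (1 / 2) ^ j := by
        rw [pow_succ]
        nlinarith [mul_nonneg hR (pow_nonneg (by norm_num : (0 : ℝ) ≤ 1 / 2) j)]
  have hpart : ∀ J, |Z (π J) - Z θ₀| ≤ ∑' j, 2 * R * (1 / 2) ^ j * b j := by
    intro J
    rw [← h0, ← Finset.sum_range_sub (fun j => Z (π j)) J]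
    refine (Finset.abs_sum_le_sum_abs _ _).trans ((Finset.sum_le_sum fun j _ => hstep j).trans ?_)
    exact hsum.sum_le_tsum _ fun j _ => by have := hb j; positivity
  exact le_of_tendsto (((hZ.tendsto θ).comp hlim).sub_const _).abs (Eventually.of_forall hpart)

end Nets

/-! ### Consequences of the Lipschitz condition. -/

theorem continuous_of_abs_sub_le {Θ : Type*} [PseudoMetricSpace Θ] {g : Θ → ℝ} {c : ℝ}
    (h : ∀ θ τ, |g θ - g τ| ≤ c * dist θ τ) : Continuous g :=
  (LipschitzWith.of_dist_le' (K := c) h).continuous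

theorem abs_expRisk_sub_le {Ω 𝕏 Θ : Type*} [MeasurableSpace Ω] [MeasurableSpace 𝕏]
    [PseudoMetricSpace Θ] {P : Measure Ω} {X : Ω → 𝕏} {f : 𝕏 → Θ → ℝ} {C : 𝕏 → ℝ} (hX : Measurable X)
    (hLip : ∀ᵐ x ∂P.map X, ∀ θ τ, |f x θ - f x τ| ≤ C x * dist θ τ)
    (hC1 : Integrable (fun ω => C (X ω)) P) (hf : ∀ θ, Integrable (fun ω => f (X ω) θ) P)
    (θ τ : Θ) : |expRisk P f X θ - expRisk P f X τ| ≤ (∫ ω, C (X ω) ∂P) * dist θ τ := by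
  rw [expRisk, expRisk, ← integral_sub (hf θ) (hf τ), ← integral_mul_const]
  refine abs_integral_le_integral_abs.trans
    (integral_mono_ae ((hf θ).sub (hf τ)).abs (hC1.mul_const _) ?_)
  filter_upwards [ae_of_ae_map hX.aemeasurable hLip] with ω hω
  exact hω θ τ

theorem memLp_of_lipschitz {Ω 𝕏 Θ : Type*} [MeasurableSpace Ω] [MeasurableSpace 𝕏]
    [PseudoMetricSpace Θ] {P : Measure Ω} {X : Ω → 𝕏} {f : 𝕏 → Θ → ℝ} {C : 𝕏 → ℝ}
    (hX : Measurable X) (hf : ∀ θ, Measurable fun x => f x θ)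
    (hLip : ∀ᵐ x ∂P.map X, ∀ θ τ, |f x θ - f x τ| ≤ C x * dist θ τ)
    (hC : Measurable C) (hCint : Integrable (fun ω => C (X ω) ^ 2) P) {τ : Θ}
    (hτ : Integrable (fun ω => f (X ω) τ ^ 2) P) (θ : Θ) : MemLp (fun ω => f (X ω) θ) 2 P := by
  have hCL : MemLp (fun ω => C (X ω)) 2 P :=
    (memLp_two_iff_integrable_sq (hC.comp hX).aestronglyMeasurable).2 hCint
  have h1 : MemLp (fun ω => f (X ω) θ - f (X ω) τ) 2 P := by
    refine (hCL.mul_const (dist θ τ)).mono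
      (((hf θ).comp hX).sub ((hf τ).comp hX)).aestronglyMeasurable ?_
    filter_upwards [ae_of_ae_map hX.aemeasurable hLip] with ω hω
    exact (hω θ τ).trans (le_abs_self _)
  have h2 : MemLp (fun ω => f (X ω) τ) 2 P :=
    (memLp_two_iff_integrable_sq ((hf τ).comp hX).aestronglyMeasurable).2 hτ
  exact (h1.add h2).ae_eq (ae_of_all _ fun ω => sub_add_cancel _ _)

/-! ### Uniform root-n tightness of the empirical risk. -/

section Tightness

variable {Ω : Type*} [MeasurableSpace Ω] {P : Measure Ω} [IsProbabilityMeasure P]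
  {𝕏 : Type*} [MeasurableSpace 𝕏] {X : Ω → 𝕏} {Xs : ℕ → Ω → 𝕏}

/-- Markov's inequality for C² gives each index a probability of order 1/n, so the union bound is
free of n. This is the cost of truncating at M√n. -/
theorem measureReal_exists_gt_le
    (hident : ∀ i, IdentDistrib (Xs i) X P P) {C : 𝕏 → ℝ} (hC : Measurable C)
    (hCint : Integrable (fun ω => C (X ω) ^ 2) P) {M : ℝ} (hM : 0 < M)
    {n : ℕ} (hn : 1 ≤ n) :
    P.real {ω | ∃ i ∈ Finset.range n, M * √n < C (Xs i ω)} ≤ (∫ ω, C (X ω) ^ 2 ∂P) / M ^ 2 := by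
  have hn0 : (0 : ℝ) < n := by exact_mod_cast hn
  have hss : √(n : ℝ) ^ 2 = n := Real.sq_sqrt hn0.le
  have hone : ∀ i, P.real {ω | M * √n < C (Xs i ω)} ≤
      (∫ ω, C (X ω) ^ 2 ∂P) / (M ^ 2 * n) := by
    intro i
    have hid := (hident i).comp (u := fun x => C x ^ 2) (hC.pow_const 2)
    have h1 := mul_meas_ge_le_integral_of_nonneg (μ := P) (f := fun ω => C (Xs i ω) ^ 2)
      (ae_of_all _ fun ω => sq_nonneg _) (hid.integrable_iff.2 hCint) (M ^ 2 * n)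
    have h2 := hid.integral_eq
    simp only [Function.comp_def] at h2
    rw [h2] at h1
    rw [le_div_iff₀ (by positivity), mul_comm]
    refine le_trans ?_ h1
    refine mul_le_mul_of_nonneg_left (measureReal_mono fun ω hω => ?_) (by positivity)
    simp only [Set.mem_ofPred_eq] at hω ⊢
    rw [← hss, ← mul_pow]
    gcongr
  have hset : {ω | ∃ i ∈ Finset.range n, M * √n < C (Xs i ω)} =
      ⋃ i ∈ Finset.range n, {ω | M * √n < C (Xs i ω)} := by
    ext ω; simp
  rw [hset]
  refine (measureReal_biUnion_finset_le _ _).trans ((Finset.sum_le_sum fun i _ => hone i).trans ?_)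
  rw [Finset.sum_const, Finset.card_range, nsmul_eq_mul]
  exact le_of_eq (by field_simp)

/-- Chebyshev's inequality; it controls the deviation at the single root point of the chain. -/
theorem measureReal_abs_sum_gt_le
    (hindep : iIndepFun Xs P) (hident : ∀ i, IdentDistrib (Xs i) X P P) {φ : 𝕏 → ℝ}
    (hφ : Measurable φ) (hφ2 : MemLp (fun ω => φ (X ω)) 2 P) {B : ℝ} (hB : 0 < B)
    {n : ℕ} (hn : 1 ≤ n) :
    P.real {ω | B * √n < |∑ i ∈ Finset.range n, (φ (Xs i ω) - ∫ ω, φ (X ω) ∂P)|} ≤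
      Var[fun ω => φ (X ω); P] / B ^ 2 := by
  have hn0 : (0 : ℝ) < n := by exact_mod_cast hn
  have hss : √(n : ℝ) ^ 2 = n := Real.sq_sqrt hn0.le
  have hid : ∀ i, IdentDistrib (fun ω => φ (Xs i ω)) (fun ω => φ (X ω)) P P :=
    fun i => (hident i).comp hφ
  have hL : ∀ i, MemLp (fun ω => φ (Xs i ω)) 2 P := fun i => (hid i).memLp_iff.2 hφ2
  have hvar : Var[∑ i ∈ Finset.range n, fun ω => φ (Xs i ω); P] =
      n * Var[fun ω => φ (X ω); P] := by
    rw [IndepFun.variance_sum (fun i _ => hL i)]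
    · rw [Finset.sum_congr rfl fun i _ => (hid i).variance_eq]
      simp
    · intro i _ j _ hij
      exact (hindep.indepFun hij).comp hφ hφ
  have hmean : ∫ ω, (∑ i ∈ Finset.range n, fun ω => φ (Xs i ω)) ω ∂P =
      n * ∫ ω, φ (X ω) ∂P := by
    simp only [Finset.sum_apply]
    rw [integral_finsetSum _ fun i _ => (hL i).integrable (by norm_num),
      Finset.sum_congr rfl fun i _ => (hid i).integral_eq]
    simp
  have hcheb := meas_ge_le_variance_div_sq (memLp_finsetSum' (Finset.range n) fun i _ => hL i)
    (c := B * √n) (by positivity)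
  rw [hvar, hmean] at hcheb
  have hv0 := variance_nonneg (fun ω => φ (X ω)) P
  refine ENNReal.toReal_le_of_le_ofReal (by positivity) ((measure_mono fun ω hω => ?_).trans
    (hcheb.trans (le_of_eq ?_)))
  · simp only [Set.mem_ofPred_eq, Finset.sum_apply, Finset.sum_sub_distrib, Finset.sum_const,
      Finset.card_range, nsmul_eq_mul] at hω ⊢
    exact hω.le
  · congr 1
    rw [mul_pow, hss]
    field_simp

variable {Θ : Type*} [MetricSpace Θ] {f : 𝕏 → Θ → ℝ} {C : 𝕏 → ℝ}

theorem measure_link_failure_le {S : ℕ → Finset Θ} {D : ℕ} (hD : 1 ≤ D)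
    (hcard : ∀ j, (S j).card ≤ D ^ j) (hX : Measurable X) (hXs : ∀ i, Measurable (Xs i))
    (hindep : iIndepFun Xs P) (hident : ∀ i, IdentDistrib (Xs i) X P P)
    (hf : ∀ θ, Measurable fun x => f x θ) (hfi : ∀ θ, Integrable (fun ω => f (X ω) θ) P)
    (hLip : ∀ᵐ x ∂P.map X, ∀ θ τ, |f x θ - f x τ| ≤ C x * dist θ τ)
    (hC : Measurable C) (hC0 : ∀ x, 0 ≤ C x) (hCint : Integrable (fun ω => C (X ω) ^ 2) P)
    {M : ℝ} (hM : 0 < M) (hCM : ∫ ω, C (X ω) ^ 2 ∂P ≤ M ^ 2) {n : ℕ} (hn : 1 ≤ n)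
    {η : ℝ} (hη : 0 < η) :
    P.real {ω | (∀ i ∈ Finset.range n, C (Xs i ω) ≤ M * √n) ∧ ∃ j, ∃ s ∈ S j, ∃ t ∈ S (j + 1),
      dist s t * (2 * M * √n * (2 - Real.log (η / (4 * D)) + j * Real.log (2 * D ^ 2))) <
      |∑ i ∈ Finset.range n, (f (Xs i ω) s - expRisk P f X s) -
        ∑ i ∈ Finset.range n, (f (Xs i ω) t - expRisk P f X t)|} ≤ η := by
  have hD0 : (0 : ℝ) < D := by exact_mod_cast hD
  -- Chosen so that 2 exp(2 − u j), times the at most D^(2j+1) links of level j, is at most (η/2)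
  -- 2^{-j}; these bounds sum to η.
  set u : ℕ → ℝ := fun j => 2 - Real.log (η / (4 * D)) + j * Real.log (2 * D ^ 2) with hu
  set E : ℕ → Θ → Θ → Set Ω := fun j s t => {ω | (∀ i ∈ Finset.range n, C (Xs i ω) ≤ M * √n) ∧
    dist s t * (2 * M * √n * u j) <
      |∑ i ∈ Finset.range n, (f (Xs i ω) s - expRisk P f X s) -
        ∑ i ∈ Finset.range n, (f (Xs i ω) t - expRisk P f X t)|} with hE
  have hexp : ∀ j, Real.exp (2 - u j) = η / (4 * D) / (2 * D ^ 2) ^ j := by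
    intro j
    have h1 : 2 - u j = Real.log (η / (4 * D)) - j * Real.log (2 * D ^ 2) := by
      simp only [hu]; ring
    rw [h1, Real.exp_sub, Real.exp_log (by positivity), Real.exp_nat_mul,
      Real.exp_log (by positivity)]
  have hlink : ∀ j s t, P.real (E j s t) ≤ 2 * (η / (4 * D) / (2 * D ^ 2) ^ j) := by
    intro j s t
    rw [← hexp]
    rcases eq_or_ne s t with rfl | hst
    -- The tail bound needs δ > 0; for coinciding endpoints the strict inequality in E reads 0 < 0.
    · have : E j s s = ∅ := by
        ext ω; simp [hE]
      rw [this, measureReal_empty]; positivity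
    · have hδ : 0 < dist s t := dist_pos.2 hst
      refine (measureReal_mono ?_).trans (measureReal_truncated_abs_sum_ge_le hX hXs hindep hident
        (φ := fun x => f x s - f x t) ((hf s).sub (hf t)) hC hC0 hδ hM
        (hLip.mono fun x hx => hx s t) hCint hCM hn (u j))
      rintro ω ⟨h1, h2⟩
      refine ⟨h1, ?_⟩
      rw [integral_sub (hfi s) (hfi t)]
      rw [← Finset.sum_sub_distrib] at h2
      calc 2 * dist s t * M * √n * u j = dist s t * (2 * M * √n * u j) := by ring
        _ ≤ _ := h2.le
        _ = _ := by
          congr 1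
          refine Finset.sum_congr rfl fun i _ => ?_
          simp only [expRisk]; ring
  have hlevel : ∀ j, P.real (⋃ p ∈ S j ×ˢ S (j + 1), E j p.1 p.2) ≤ η / 2 * (1 / 2) ^ j := by
    intro j
    refine (measureReal_biUnion_finset_le _ _).trans
      ((Finset.sum_le_sum fun p _ => hlink j p.1 p.2).trans ?_)
    rw [Finset.sum_const, nsmul_eq_mul, Finset.card_product]
    have hc : (((S j).card * (S (j + 1)).card : ℕ) : ℝ) ≤ D ^ j * D ^ (j + 1) := by
      exact_mod_cast Nat.mul_le_mul (hcard j) (hcard (j + 1))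
    calc _ ≤ (D : ℝ) ^ j * D ^ (j + 1) * (2 * (η / (4 * D) / (2 * D ^ 2) ^ j)) := by gcongr
      _ = η / 2 * (1 / 2) ^ j := by
        rw [mul_pow, ← pow_mul, pow_succ, mul_comm 2 j, pow_mul, div_pow, one_pow]
        field_simp
        ring
  have hg : Summable fun j : ℕ => η / 2 * (1 / 2 : ℝ) ^ j :=
    (summable_geometric_of_lt_one (by norm_num) (by norm_num)).mul_left _
  refine ENNReal.toReal_le_of_le_ofReal hη.le ?_
  calc P _ ≤ P (⋃ j, ⋃ p ∈ S j ×ˢ S (j + 1), E j p.1 p.2) := by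
        refine measure_mono ?_
        rintro ω ⟨h1, j, s, hs, t, ht, h2⟩
        simp only [Set.mem_iUnion]
        exact ⟨j, (s, t), Finset.mem_product.2 ⟨hs, ht⟩, h1, h2⟩
    _ ≤ ∑' j, P (⋃ p ∈ S j ×ˢ S (j + 1), E j p.1 p.2) := measure_iUnion_le _
    _ ≤ ∑' j : ℕ, ENNReal.ofReal (η / 2 * (1 / 2) ^ j) :=
        ENNReal.tsum_le_tsum fun j => by
          rw [← ofReal_measureReal (measure_ne_top _ _)]
          exact ENNReal.ofReal_le_ofReal (hlevel j)
    _ = ENNReal.ofReal η := by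
        rw [← ENNReal.ofReal_tsum_of_nonneg (fun j => by positivity) hg, tsum_mul_left,
          tsum_geometric_of_lt_one (by norm_num) (by norm_num)]
        congr 1; ring

/-- The deviations of the empirical risk from the expected risk are uniformly of order `1 / √n` in
probability over a parameter space with geometric nets. -/
theorem exists_uniform_deviation_bound [Nonempty Θ] {S : ℕ → Finset Θ} {D : ℕ} {R : ℝ}
    (hD : 1 ≤ D) (hcard : ∀ j, (S j).card ≤ D ^ j)
    (hS : ∀ (θ : Θ) (j : ℕ), ∃ s ∈ S j, dist θ s ≤ R * (1 / 2) ^ j)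
    (hX : Measurable X) (hXs : ∀ i, Measurable (Xs i))
    (hindep : iIndepFun Xs P) (hident : ∀ i, IdentDistrib (Xs i) X P P)
    (hf : ∀ θ, Measurable fun x => f x θ) (hf2 : ∀ θ, MemLp (fun ω => f (X ω) θ) 2 P)
    (hLip : ∀ᵐ x ∂P.map X, ∀ θ τ, |f x θ - f x τ| ≤ C x * dist θ τ)
    (hC : Measurable C) (hC0 : ∀ x, 0 ≤ C x) (hCint : Integrable (fun ω => C (X ω) ^ 2) P)
    {ε : ℝ} (hε : 0 < ε) :
    ∃ B : ℝ, ∀ n : ℕ, 1 ≤ n →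
      P.real {ω | ∃ θ, B / √n < |empRisk f Xs n ω θ - expRisk P f X θ|} ≤ ε := by
  have hfi : ∀ θ, Integrable (fun ω => f (X ω) θ) P := fun θ => (hf2 θ).integrable (by norm_num)
  have hC1 : Integrable (fun ω => C (X ω)) P := by
    have : MemLp (fun ω => C (X ω)) 2 P :=
      (memLp_two_iff_integrable_sq (hC.comp hX).aestronglyMeasurable).2 hCint
    exact this.integrable (by norm_num)
  -- The net at level 0 has at most D^0 = 1 point, so all chains start at the same root.
  obtain ⟨θ₀, hθ₀⟩ : ∃ θ₀, S 0 = {θ₀} := by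
    obtain ⟨s, hs, -⟩ := hS (Classical.arbitrary Θ) 0
    refine ⟨s, Finset.eq_singleton_iff_unique_mem.2 ⟨hs, fun t ht => ?_⟩⟩
    exact Finset.card_le_one.1 (by simpa using hcard 0) t ht s hs
  set σ2 := ∫ ω, C (X ω) ^ 2 ∂P with hσ
  have hσ0 : 0 ≤ σ2 := integral_nonneg fun ω => sq_nonneg _
  obtain ⟨M, hM, hM1, hM2⟩ : ∃ M : ℝ, 0 < M ∧ σ2 ≤ M ^ 2 ∧ σ2 / M ^ 2 ≤ ε / 3 := by
    refine ⟨√(1 + σ2 + 3 * σ2 / ε), by positivity, ?_, ?_⟩ <;>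
      rw [Real.sq_sqrt (by positivity)]
    · have : 0 ≤ 3 * σ2 / ε := by positivity
      linarith
    · rw [div_le_iff₀ (by positivity)]
      have : ε / 3 * (1 + σ2 + 3 * σ2 / ε) = ε / 3 * (1 + σ2) + σ2 := by field_simp
      rw [this]
      have : 0 ≤ ε / 3 * (1 + σ2) := by positivity
      linarith
  set V := Var[fun ω => f (X ω) θ₀; P] with hV
  have hV0 : 0 ≤ V := variance_nonneg _ _
  obtain ⟨B₀, hB₀, hB₁⟩ : ∃ B₀ : ℝ, 0 < B₀ ∧ V / B₀ ^ 2 ≤ ε / 3 := by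
    refine ⟨√(1 + 3 * V / ε), by positivity, ?_⟩
    rw [Real.sq_sqrt (by positivity), div_le_iff₀ (by positivity)]
    have : ε / 3 * (1 + 3 * V / ε) = ε / 3 + V := by field_simp
    linarith
  -- The cap at 1 makes the logarithm of η / (4D) nonpositive, hence u j ≥ 0.
  set η := min (ε / 3) 1 with hη
  have hη0 : 0 < η := by positivity
  have hD0 : (1 : ℝ) ≤ D := by exact_mod_cast hD
  have hlogD : 0 ≤ Real.log (2 * D ^ 2) := Real.log_nonneg (by nlinarith)
  have hlogη : Real.log (η / (4 * D)) ≤ 0 := by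
    refine Real.log_nonpos (by positivity) ?_
    rw [div_le_one (by positivity)]
    have := min_le_right (ε / 3) 1
    linarith
  set u : ℕ → ℝ := fun j => 2 - Real.log (η / (4 * D)) + j * Real.log (2 * D ^ 2) with hu
  have hu0 : ∀ j, 0 ≤ u j := fun j => by
    have : 0 ≤ (j : ℝ) * Real.log (2 * D ^ 2) := by positivity
    simp only [hu]; linarith
  have hsum : Summable fun j => 2 * R * (1 / 2) ^ j * (2 * M * u j) := by
    have h1 : Summable fun j : ℕ => (1 / 2 : ℝ) ^ j :=
      summable_geometric_of_lt_one (by norm_num) (by norm_num)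
    have h2 : Summable fun j : ℕ => (j : ℝ) ^ 1 * (1 / 2 : ℝ) ^ j :=
      summable_pow_mul_geometric_of_norm_lt_one 1 (by norm_num)
    refine ((h1.mul_left (4 * R * M * (2 - Real.log (η / (4 * D))))).add
      (h2.mul_left (4 * R * M * Real.log (2 * D ^ 2)))).congr fun j => ?_
    simp only [hu]; ring
  set K := ∑' j, 2 * R * (1 / 2) ^ j * (2 * M * u j) with hK
  refine ⟨K + B₀, fun n hn => ?_⟩
  have hn0 : (0 : ℝ) < n := by exact_mod_cast hn
  have hs0 : 0 < √(n : ℝ) := Real.sqrt_pos.2 hn0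
  have hss : √(n : ℝ) * √n = n := Real.mul_self_sqrt hn0.le
  set Z : Ω → Θ → ℝ := fun ω θ => ∑ i ∈ Finset.range n, (f (Xs i ω) θ - expRisk P f X θ) with hZ
  have hZn : ∀ ω θ, empRisk f Xs n ω θ - expRisk P f X θ = Z ω θ / n := by
    intro ω θ
    simp only [hZ, empRisk, Finset.sum_sub_distrib, Finset.sum_const, Finset.card_range,
      nsmul_eq_mul]
    field_simp
  have hlip : ∀ᵐ ω ∂P, ∀ i, ∀ θ τ, |f (Xs i ω) θ - f (Xs i ω) τ| ≤ C (Xs i ω) * dist θ τ :=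
    ae_all_iff.2 fun i => ae_comp_of_identDistrib (hident i) hLip
  set F₁ := {ω | ∃ i ∈ Finset.range n, M * √n < C (Xs i ω)} with hF₁
  set F₂ := {ω | B₀ * √n < |Z ω θ₀|} with hF₂
  set F₃ := {ω | (∀ i ∈ Finset.range n, C (Xs i ω) ≤ M * √n) ∧ ∃ j, ∃ s ∈ S j,
    ∃ t ∈ S (j + 1), dist s t * (2 * M * √n * u j) < |Z ω s - Z ω t|} with hF₃
  have h₁ : P.real F₁ ≤ ε / 3 := (measureReal_exists_gt_le hident hC hCint hM hn).trans hM2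
  have h₂ : P.real F₂ ≤ ε / 3 :=
    (measureReal_abs_sum_gt_le hindep hident (hf θ₀) (hf2 θ₀) hB₀ hn).trans hB₁
  have h₃ : P.real F₃ ≤ ε / 3 :=
    (measure_link_failure_le hD hcard hX hXs hindep hident hf hfi hLip hC hC0 hCint hM hM1 hn
      hη0).trans (min_le_left _ _)
  -- The inclusion holds only almost surely: the chaining limit needs continuity in θ, which comes
  -- from the almost sure Lipschitz bound.
  have hsub : ∀ᵐ ω ∂P, (∃ θ, (K + B₀) / √n < |empRisk f Xs n ω θ - expRisk P f X θ|) →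
      ω ∈ F₁ ∪ F₂ ∪ F₃ := by
    filter_upwards [hlip] with ω hω
    rintro ⟨θ, hθ⟩
    by_contra hF
    simp only [Set.mem_union, not_or] at hF
    obtain ⟨⟨g₁, g₂⟩, g₃⟩ := hF
    have g₁' : ∀ i ∈ Finset.range n, C (Xs i ω) ≤ M * √n := fun i hi =>
      not_lt.1 fun hlt => g₁ ⟨i, hi, hlt⟩
    have g₂' : |Z ω θ₀| ≤ B₀ * √n := not_lt.1 g₂
    have hcont : Continuous (Z ω) :=
      continuous_finsetSum _ fun i _ => (continuous_of_abs_sub_le (hω i)).sub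
        (continuous_of_abs_sub_le (abs_expRisk_sub_le hX hLip hC1 hfi))
    have hterm : ∀ j, 2 * R * (1 / 2) ^ j * (2 * M * √n * u j) =
        √n * (2 * R * (1 / 2) ^ j * (2 * M * u j)) := fun j => by ring
    have hch := abs_sub_le_of_nets hS hθ₀ hcont (b := fun j => 2 * M * √n * u j)
      (fun j => by have := hu0 j; positivity)
      (fun j s hs t ht => not_lt.1 fun hlt => g₃ ⟨g₁', j, s, hs, t, ht, hlt⟩)
      (by simpa only [hterm] using hsum.mul_left _) θ
    simp only [hterm] at hch
    rw [tsum_mul_left, ← hK] at hch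
    rw [hZn, abs_div, abs_of_pos hn0, div_lt_div_iff₀ hs0 hn0] at hθ
    have htri := abs_sub_abs_le_abs_sub (Z ω θ) (Z ω θ₀)
    have hle : |Z ω θ| ≤ (K + B₀) * √n := by linarith
    have := mul_le_mul_of_nonneg_right hle hs0.le
    rw [mul_assoc, hss] at this
    linarith
  calc _ ≤ P.real (F₁ ∪ F₂ ∪ F₃) :=
        ENNReal.toReal_mono (measure_ne_top _ _) (measure_mono_ae hsub)
    _ ≤ P.real F₁ + P.real F₂ + P.real F₃ :=
        (measureReal_union_le _ _).trans (add_le_add_left (measureReal_union_le _ _) _)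
    _ ≤ ε := by linarith

end Tightness

/-! ### The smallest minimiser and its measurability. -/

section MinArgmin

variable {m : ℕ} [NeZero m]

theorem minArgmin_spec (f : Fin m → ℝ) :
    (∀ l, f (minArgmin f) ≤ f l) ∧ ∀ l < minArgmin f, f (minArgmin f) < f l := by
  have hmem := Finset.min'_mem (Finset.univ.filter fun k => ∀ l, f k ≤ f l) (by
    obtain ⟨k, hk⟩ := Finite.exists_min f
    exact ⟨k, by simpa using hk⟩)
  have h1 : ∀ l, f (minArgmin f) ≤ f l := (Finset.mem_filter.1 hmem).2
  refine ⟨h1, fun l hl => (h1 l).lt_of_ne fun heq => ?_⟩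
  refine absurd (Finset.min'_le (Finset.univ.filter fun k => ∀ l, f k ≤ f l) l ?_) (not_le.2 hl)
  exact Finset.mem_filter.2 ⟨Finset.mem_univ _, fun j => heq ▸ h1 j⟩

theorem minArgmin_eq_iff (f : Fin m → ℝ) (k : Fin m) :
    minArgmin f = k ↔ (∀ l, f k ≤ f l) ∧ ∀ l < k, f k < f l := by
  refine ⟨fun h => h ▸ minArgmin_spec f, fun ⟨h1, h2⟩ => ?_⟩
  obtain ⟨g1, g2⟩ := minArgmin_spec f
  rcases lt_trichotomy (minArgmin f) k with h | h | h
  · exact absurd (h2 _ h) (not_lt.2 (g1 k))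
  · exact h
  · exact absurd (g2 _ h) (not_lt.2 (h1 _))

theorem measurable_minArgmin : Measurable (minArgmin : (Fin m → ℝ) → Fin m) := by
  refine measurable_to_countable' fun k => ?_
  have : minArgmin ⁻¹' {k} =
      (⋂ l, {f : Fin m → ℝ | f k ≤ f l}) ∩ ⋂ l, ⋂ (_ : l < k), {f : Fin m → ℝ | f k < f l} := by
    ext f
    simp [minArgmin_eq_iff]
  rw [this]
  refine (MeasurableSet.iInter fun l => ?_).inter
    (MeasurableSet.iInter fun l => MeasurableSet.iInter fun _ => ?_)
  · exact measurableSet_le (measurable_pi_apply k) (measurable_pi_apply l)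
  · exact measurableSet_lt (measurable_pi_apply k) (measurable_pi_apply l)

end MinArgmin

/-! ### Infima over the parameter set. -/

theorem abs_ciInf_sub_ciInf_le {ι : Type*} [Nonempty ι] {g h : ι → ℝ} {c : ℝ}
    (hh : BddBelow (Set.range h)) (hgh : ∀ i, |g i - h i| ≤ c) :
    |(⨅ i, g i) - ⨅ i, h i| ≤ c := by
  have hg : BddBelow (Set.range g) := by
    obtain ⟨b, hb⟩ := hh
    refine ⟨b - c, ?_⟩
    rintro _ ⟨i, rfl⟩
    have h1 : b ≤ h i := hb ⟨i, rfl⟩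
    linarith [(abs_le.1 (hgh i)).1]
  rw [abs_le]
  constructor
  · have : (⨅ i, h i) - c ≤ ⨅ i, g i := le_ciInf fun i => by
      have := ciInf_le hh i
      linarith [(abs_le.1 (hgh i)).1]
    linarith
  · have : (⨅ i, g i) - c ≤ ⨅ i, h i := le_ciInf fun i => by
      have := ciInf_le hg i
      linarith [(abs_le.1 (hgh i)).2]
    linarith

theorem exists_forall_le_of_continuous {Θ : Type*} [TopologicalSpace Θ] [CompactSpace Θ]
    [Nonempty Θ] {g : Θ → ℝ} (hg : Continuous g) : ∃ θ, ∀ τ, g θ ≤ g τ := by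
  obtain ⟨θ, -, h⟩ := isCompact_univ.exists_isMinOn Set.univ_nonempty hg.continuousOn
  exact ⟨θ, fun τ => h (Set.mem_univ τ)⟩

/-- By continuity the infimum may be taken over a countable dense set. -/
theorem aemeasurable_iInf_of_continuous {Ω Θ : Type*} [MeasurableSpace Ω] {P : Measure Ω}
    [TopologicalSpace Θ] [TopologicalSpace.SeparableSpace Θ] {G : Ω → Θ → ℝ}
    (hm : ∀ θ, Measurable fun ω => G ω θ) (hc : ∀ᵐ ω ∂P, Continuous (G ω)) :
    AEMeasurable (fun ω => ⨅ θ, G ω θ) P := by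
  obtain ⟨s, hs, hd⟩ := TopologicalSpace.exists_countable_dense Θ
  have := hs.to_subtype
  refine ⟨fun ω => ⨅ θ : s, G ω θ, Measurable.iInf fun θ => hm θ, ?_⟩
  filter_upwards [hc] with ω hω
  exact (hd.ciInf' hω).symm

/-! ### Comparison of the penalised criteria. -/

section Consistency

variable {Ω : Type*} [MeasurableSpace Ω] {P : Measure Ω} [IsProbabilityMeasure P]

/-- Consistency of penalised selection from root-`n` tightness of the criterion values. -/
theorem tendsto_measure_minArgmin_eq {m : ℕ} [NeZero m] {I : Fin m → ℕ → Ω → ℝ} {r : Fin m → ℝ}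
    (hI : ∀ k, ∀ ε > 0, ∃ B : ℝ, ∀ n : ℕ, 1 ≤ n → P.real {ω | B / √n < |I k n ω - r k|} ≤ ε)
    {pen : Fin m → ℕ → Ω → ℝ} (hpen_meas : ∀ k n, 1 ≤ n → Measurable (pen k n))
    (hpen_pos : ∀ k n, 1 ≤ n → ∀ ω, 0 < pen k n ω)
    (hpen_zero : ∀ k, TendstoInMeasure P (pen k) atTop (fun _ => 0))
    (hpen_gap : ∀ k l, k < l → TendstoAtTopInProb P (fun n ω => √n * (pen l n ω - pen k n ω))) :
    Tendsto (fun n => P {ω | minArgmin (fun k => I k n ω + pen k n ω) = minArgmin r}) atTop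
      (𝓝 1) := by
  set k := minArgmin r with hk
  obtain ⟨hmin, hlt⟩ := minArgmin_spec r
  rw [← hk] at hmin hlt
  have hbad : ∀ l, l ≠ k → ∀ ε > 0, ∀ᶠ n in atTop,
      P.real {ω | I l n ω + pen l n ω ≤ I k n ω + pen k n ω} ≤ ε := by
    intro l hl ε hε
    obtain ⟨Bl, hBl⟩ := hI l (ε / 3) (by positivity)
    obtain ⟨Bk, hBk⟩ := hI k (ε / 3) (by positivity)
    have hunion : ∀ n : ℕ, 1 ≤ n → ∀ A : Set Ω, P.real A ≤ ε / 3 →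
        {ω | I l n ω + pen l n ω ≤ I k n ω + pen k n ω} ⊆
          {ω | Bl / √n < |I l n ω - r l|} ∪ {ω | Bk / √n < |I k n ω - r k|} ∪ A →
        P.real {ω | I l n ω + pen l n ω ≤ I k n ω + pen k n ω} ≤ ε := by
      intro n hn A hA hsub
      calc _ ≤ P.real ({ω | Bl / √n < |I l n ω - r l|} ∪ {ω | Bk / √n < |I k n ω - r k|} ∪ A) :=
            measureReal_mono hsub
        _ ≤ P.real {ω | Bl / √n < |I l n ω - r l|} + P.real {ω | Bk / √n < |I k n ω - r k|} +
            P.real A :=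
            (measureReal_union_le _ _).trans (add_le_add_left (measureReal_union_le _ _) _)
        _ ≤ ε := by linarith [hBl n hn, hBk n hn]
    rcases (hmin l).lt_or_eq with hlt' | heq
    -- Strict gap: both deviations and the penalty of k stay below δ/4, and the penalty of l is
    -- positive, so l would win only if δ < 3δ/4.
    · set δ := r l - r k with hδ
      have hδ0 : 0 < δ := sub_pos.2 hlt'
      have hsqrt : Tendsto (fun n : ℕ => √(n : ℝ)) atTop atTop :=
        Real.tendsto_sqrt_atTop.comp tendsto_natCast_atTop_atTop
      have h1 : ∀ B : ℝ, ∀ᶠ n : ℕ in atTop, B / √n < δ / 4 := fun B =>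
        (hsqrt.const_div_atTop B).eventually_lt_const (by positivity)
      have h2 : ∀ᶠ n in atTop, P.real {ω | δ / 4 ≤ ‖pen k n ω - 0‖} ≤ ε / 3 := by
        have := (ENNReal.tendsto_toReal ENNReal.zero_ne_top).comp
          (tendstoInMeasure_iff_norm.1 (hpen_zero k) (δ / 4) (by positivity))
        exact (this.eventually_lt_const (u := ε / 3) (by simpa using hε)).mono fun n hn => hn.le
      filter_upwards [h1 Bl, h1 Bk, h2, eventually_ge_atTop 1] with n g1 g2 g3 hn
      refine hunion n hn _ g3 fun ω hω => ?_
      by_contra hc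
      simp only [Set.mem_union, Set.mem_ofPred_eq, not_or, not_lt, not_le, sub_zero,
        Real.norm_eq_abs] at hc hω
      obtain ⟨⟨c1, c2⟩, c3⟩ := hc
      have p1 := hpen_pos l n hn ω
      linarith [le_abs_self (pen k n ω), (abs_le.1 c1).1, (abs_le.1 c2).2]
    -- Tie: k is the smallest minimiser, so k < l, and l wins only if a deviation bound fails or √n
    -- times the penalty gap is at most Bl + Bk.
    · have hkl : k < l := lt_of_le_of_ne
        (not_lt.1 fun h => (hlt l h).ne heq) hl.symm
      have h2 : ∀ᶠ n : ℕ in atTop,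
          P.real {ω | Bl + Bk < √n * (pen l n ω - pen k n ω)}ᶜ ≤ ε / 3 := by
        have := (ENNReal.tendsto_toReal ENNReal.one_ne_top).comp (hpen_gap k l hkl (Bl + Bk))
        filter_upwards [this.eventually_const_lt (u := 1 - ε / 3)
          (by rw [ENNReal.toReal_one]; linarith), eventually_ge_atTop 1] with n hn hn1
        have hms : MeasurableSet {ω | Bl + Bk < √n * (pen l n ω - pen k n ω)} :=
          measurableSet_lt measurable_const
            (((hpen_meas l n hn1).sub (hpen_meas k n hn1)).const_mul _)
        rw [probReal_compl_eq_one_sub hms]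
        have : 1 - ε / 3 < P.real {ω | Bl + Bk < √n * (pen l n ω - pen k n ω)} := hn
        linarith
      filter_upwards [h2, eventually_ge_atTop 1] with n g hn
      refine hunion n hn _ g fun ω hω => ?_
      by_contra hc
      simp only [Set.mem_union, Set.mem_compl_iff, Set.mem_ofPred_eq, not_or, not_lt,
        not_le] at hc hω
      obtain ⟨⟨c1, c2⟩, c3⟩ := hc
      have hs0 : 0 < √(n : ℝ) := Real.sqrt_pos.2 (by exact_mod_cast hn)
      rw [mul_comm, ← div_lt_iff₀ hs0, add_div] at c3
      linarith [(abs_le.1 c1).1, (abs_le.1 c2).2]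
  refine tendsto_order.2 ⟨fun a ha => ?_, fun a ha => Eventually.of_forall fun n =>
    prob_le_one.trans_lt ha⟩
  have ha' : a.toReal < 1 := by
    simpa using (ENNReal.toReal_lt_toReal ha.ne_top ENNReal.one_ne_top).2 ha
  have hm : (0 : ℝ) < m := by exact_mod_cast NeZero.pos m
  have hall : ∀ᶠ n in atTop, ∀ l, l ≠ k →
      P.real {ω | I l n ω + pen l n ω ≤ I k n ω + pen k n ω} ≤ (1 - a.toReal) / (2 * m) :=
    eventually_all.2 fun l => eventually_imp_distrib_left.2 fun hl =>
      hbad l hl _ (div_pos (sub_pos.2 ha') (by positivity))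
  filter_upwards [hall] with n hn
  set G := {ω | minArgmin (fun k => I k n ω + pen k n ω) = k} with hG
  set U := ⋃ l ∈ Finset.univ.filter (· ≠ k), {ω | I l n ω + pen l n ω ≤ I k n ω + pen k n ω}
    with hU
  have hcover : Set.univ ⊆ G ∪ U := by
    intro ω _
    by_contra hc
    simp only [Set.mem_union, not_or] at hc
    obtain ⟨c1, c2⟩ := hc
    have hall' : ∀ l, l ≠ k → I k n ω + pen k n ω < I l n ω + pen l n ω := fun l hl =>
      not_le.1 fun hle => c2 (Set.mem_biUnion (Finset.mem_coe.2
        (Finset.mem_filter.2 ⟨Finset.mem_univ l, hl⟩)) hle)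
    refine c1 ((minArgmin_eq_iff _ k).2 ⟨fun l => ?_, fun l hl => hall' l hl.ne⟩)
    rcases eq_or_ne l k with rfl | hl
    · exact le_rfl
    · exact (hall' l hl).le
  have hUle : P.real U ≤ (1 - a.toReal) / 2 := by
    refine (measureReal_biUnion_finset_le _ _).trans
      ((Finset.sum_le_card_nsmul _ _ _ fun l hl => hn l (Finset.mem_filter.1 hl).2).trans ?_)
    rw [nsmul_eq_mul]
    have hcard : ((Finset.univ.filter (· ≠ k)).card : ℝ) ≤ m := by
      exact_mod_cast (Finset.card_filter_le _ _).trans (by simp)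
    have h0 : 0 ≤ (1 - a.toReal) / (2 * m) := div_nonneg (sub_pos.2 ha').le (by positivity)
    calc _ ≤ (m : ℝ) * ((1 - a.toReal) / (2 * m)) := by gcongr
      _ = _ := by field_simp
  -- Subadditivity rather than complementation, so G need not be measurable.
  have h1 : 1 ≤ P.real G + P.real U := by
    calc (1 : ℝ) = P.real Set.univ := probReal_univ.symm
      _ ≤ _ := (measureReal_mono hcover).trans (measureReal_union_le _ _)
  refine (ENNReal.toReal_lt_toReal ha.ne_top (measure_ne_top _ _)).1 ?_
  change a.toReal < P.real G
  linarith

end Consistency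

/-! ### Assembly of the result. -/

theorem theorem1
    {Ω : Type*} [MeasurableSpace Ω] (P : Measure Ω) [IsProbabilityMeasure P]
    -- the sample space, a subset of `ℝ^d` with its Borel sets
    {d : ℕ} (𝕏 : Set (EuclideanSpace ℝ (Fin d)))
    -- `X` and an IID sequence of copies of it
    (X : Ω → 𝕏) (hX : Measurable X)
    (Xs : ℕ → Ω → 𝕏) (hXs : ∀ i, Measurable (Xs i))
    (hindep : iIndepFun Xs P) (hident : ∀ i, IdentDistrib (Xs i) X P P)
    -- parameter sets, hypotheses and loss; `L k x θ` is `ℓ_k(x; θ) = ℓ(h_k(x; θ))`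
    {m : ℕ} [NeZero m] (q : Fin m → ℕ) (T : (k : Fin m) → Set (EuclideanSpace ℝ (Fin (q k))))
    (h : (k : Fin m) → 𝕏 → T k → ℝ) (loss : ℝ → ℝ)
    (L : (k : Fin m) → 𝕏 → T k → ℝ) (hL : ∀ k x θ, L k x θ = loss (h k x θ))
    (hmeas : ∀ k (θ : T k), Measurable (fun x => L k x θ))
    -- compactness, and square integrability at one parameter
    (hcompact : ∀ k, IsCompact (T k))
    (hsq : ∀ k, ∃ τ : T k, Integrable (fun ω => (L k (X ω) τ) ^ 2) P)
    -- Lipschitz condition with a square integrable constant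
    (hLip : ∀ k, ∃ C : 𝕏 → ℝ≥0, Measurable C ∧ Integrable (fun ω => (C (X ω) : ℝ) ^ 2) P ∧
      ∀ᵐ x ∂(P.map X), ∀ θ τ : T k,
        |L k x θ - L k x τ| ≤ C x * ‖(θ : EuclideanSpace ℝ (Fin (q k))) - τ‖)
    -- the penalties, random variables on `Ω`, for `n ≥ 1`
    (pen : Fin m → ℕ → Ω → ℝ) (hpen_meas : ∀ k n, 1 ≤ n → Measurable (pen k n))
    (hpen_pos : ∀ k n, 1 ≤ n → ∀ ω, 0 < pen k n ω)
    (hpen_zero : ∀ k, TendstoInMeasure P (pen k) atTop (fun _ => 0))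
    (hpen_gap : ∀ k l, k < l →
      TendstoAtTopInProb P (fun n ω => Real.sqrt n * (pen l n ω - pen k n ω))) :
    -- the expected risks are finite, and all minima that occur are attained
    (∀ k (θ : T k), Integrable (fun ω => L k (X ω) θ) P) ∧
    (∀ k, ∃ θ : T k, ∀ τ : T k, expRisk P (L k) X θ ≤ expRisk P (L k) X τ) ∧
    (∀ n, 1 ≤ n → ∀ᵐ ω ∂P, ∀ k, ∃ θ : T k, ∀ τ : T k,
      empRisk (L k) Xs n ω θ ≤ empRisk (L k) Xs n ω τ) ∧
    -- the estimator is a random variable, and it is consistent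
    (∀ n, 1 ≤ n → AEMeasurable (penEstimator L Xs pen n) P) ∧
    Tendsto (fun n => P {ω | penEstimator L Xs pen n ω = optIndex P L X}) atTop (𝓝 1) := by
  choose τ hτ using hsq
  choose C hC hCint hLipC using hLip
  have hne : ∀ k, Nonempty (T k) := fun k => ⟨τ k⟩
  have hcs : ∀ k, CompactSpace (T k) := fun k => isCompact_iff_compactSpace.1 (hcompact k)
  have hC' : ∀ k, Measurable fun x => (C k x : ℝ) := fun k => (hC k).coe_nnreal_real
  have hLip' : ∀ k, ∀ᵐ x ∂P.map X, ∀ θ τ : T k, |L k x θ - L k x τ| ≤ C k x * dist θ τ :=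
    fun k => (hLipC k).mono fun x hx θ τ => by
      rw [Subtype.dist_eq, dist_eq_norm]; exact hx θ τ
  have hL2 : ∀ k (θ : T k), MemLp (fun ω => L k (X ω) θ) 2 P := fun k θ =>
    memLp_of_lipschitz hX (hmeas k) (hLip' k) (hC' k) (hCint k) (hτ k) θ
  have hLi : ∀ k (θ : T k), Integrable (fun ω => L k (X ω) θ) P := fun k θ =>
    (hL2 k θ).integrable (by norm_num)
  have hC1 : ∀ k, Integrable (fun ω => (C k (X ω) : ℝ)) P := fun k =>
    ((memLp_two_iff_integrable_sq ((hC' k).comp hX).aestronglyMeasurable).2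
      (hCint k)).integrable (by norm_num)
  have hrmin : ∀ k, ∃ θ : T k, ∀ τ : T k, expRisk P (L k) X θ ≤ expRisk P (L k) X τ := fun k =>
    exists_forall_le_of_continuous
      (continuous_of_abs_sub_le (abs_expRisk_sub_le hX (hLip' k) (hC1 k) (hLi k)))
  have hcont : ∀ n k, ∀ᵐ ω ∂P, Continuous (empRisk (L k) Xs n ω) := by
    intro n k
    have : ∀ᵐ ω ∂P, ∀ i, ∀ θ τ : T k,
        |L k (Xs i ω) θ - L k (Xs i ω) τ| ≤ C k (Xs i ω) * dist θ τ :=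
      ae_all_iff.2 fun i => ae_comp_of_identDistrib (hident i) (hLip' k)
    filter_upwards [this] with ω hω
    exact continuous_const.mul
      (continuous_finsetSum _ fun i _ => continuous_of_abs_sub_le (hω i))
  refine ⟨hLi, hrmin, fun n _ => ?_, fun n hn => ?_, ?_⟩
  · filter_upwards [ae_all_iff.2 (hcont n)] with ω hω k
    exact exists_forall_le_of_continuous (hω k)
  · refine measurable_minArgmin.comp_aemeasurable (aemeasurable_pi_lambda _ fun k => ?_)
    refine (aemeasurable_iInf_of_continuous (fun θ => ?_) (hcont n k)).add
      (hpen_meas k n hn).aemeasurable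
    exact (Finset.measurable_sum _ fun i _ => (hmeas k θ).comp (hXs i)).const_mul _
  · refine tendsto_measure_minArgmin_eq (fun k ε hε => ?_) hpen_meas hpen_pos hpen_zero hpen_gap
    obtain ⟨D, R, S, hD, hcard, hS⟩ := exists_nets_of_isBounded (hcompact k).isBounded
    obtain ⟨B, hB⟩ := exists_uniform_deviation_bound hD hcard hS hX hXs hindep hident (hmeas k)
      (hL2 k) (hLip' k) (hC' k) (fun x => (C k x).2) (hCint k) hε
    refine ⟨B, fun n hn => (measureReal_mono fun ω hω => ?_).trans (hB n hn)⟩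
    by_contra hc
    have hc' : ∀ θ : T k, |empRisk (L k) Xs n ω θ - expRisk P (L k) X θ| ≤ B / √n := fun θ =>
      not_lt.1 fun hlt => hc ⟨θ, hlt⟩
    obtain ⟨θ₀, hθ₀⟩ := hrmin k
    -- Needed because a real infimum over a set unbounded below takes the default value 0.
    have hbdd : BddBelow (Set.range (expRisk P (L k) X)) :=
      ⟨_, by rintro _ ⟨τ, rfl⟩; exact hθ₀ τ⟩
    exact absurd hω (not_lt.2 (abs_ciInf_sub_ciInf_le hbdd hc'))
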